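/- \textbf{Setting.} Let $\mathcal Y$ be a real Hilbert space (for instance $L^2(\Omega_y)$), let $n,p\in\mathbb N$, let $\mathcal X_1,\dots,\mathcal X_p$ be sets, and for each $l$ let $K_l:\mathcal X_l\times\mathcal X_l\to\mathcal L(\mathcal Y)$ be a nonnegative operator-valued kernel: $K_l(w,z)=K_l(z,w)^*$, and all matrices $(\langle K_l(w_i,w_j)v_i,v_j\rangle)_{i,j}$ are positive semidefinite. Let $x_i^{(l)}\in\mathcal X_l$, $y_i\in\mathcal Y$ ($1\le i\le n$, $1\le l\le p$), $\lambda_1,\lambda_2>0$, $\mathbb R_+^p=\{\theta\in\mathbb R^p:\theta_l\ge 0 \text{ for all } l\}$, and for $u\in\mathcal Y^n$, $\theta\in\mathbb R^p$ put $$q(u,\theta)=\sum_{i=1}^n\Big\|y_i-\sum_{l=1}^p\sum_{j=1}^n\theta_lK_l(x_j^{(l)},x_i^{(l)})u_j\Big\|^2+\lambda_1\sum_{l=1}^p\theta_l\sum_{i,j=1}^n\langle K_l(x_i^{(l)},x_j^{(l)})u_i,u_j\rangle+\lambda_2\sum_{l=1}^p\theta_l ,$$ $m_\theta(u)=q(u,\theta)-\lambda_2\sum_l\theta_l$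 and $h_u(\theta)=q(u,\theta)$. Let $(\hat u,\hat\theta)$ be a global minimizer of $q$ over $\mathcal Y^n\times\mathbb R_+^p$. The spaces $\mathcal Y^n$ and $\mathbb R^p$ carry their Euclidean (Hilbert) norms, $\|(u,\theta)\|=\|u\|+\|\theta\|$ on $\mathcal Y^n\times\mathbb R^p$, likewise $\|\nabla q\|=\|\nabla_uq\|+\|\nabla_\theta q\|$, and $B(r)$ denotes the closed ball of radius $r$ around $(\hat u,\hat\theta)$ in $\mathcal Y^n\times\mathbb R^p$. \textbf{BCD sequences.} $(u_k,\theta_k)_{k\ge0}$ is a BCD sequence if $\theta_0\in\mathbb R^p_+$ and, for all $k\ge1$, $u_k$ minimizes $m_{\theta_{k-1}}$ over $\mathcal Y^n$ and $\theta_k$ minimizes $h_{u_{k-1}}$ over $\mathbb R_+^p$ (simultaneous updates), or if the same holds with $h_{u_k}$ in place of $h_{u_{k-1}}$ for all $k\ge 1$ (sequential updates). \textbf{Strong convexity assumption} with constants $0<\underline M\le\overline M$, $0<\underline H\le\overline H$: for every $k\ge0$, $m_{\theta_k}$ is strongly convex on $\mathcal Y^n$ with some modulus $M_k\in[\underline M,\overline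 M]$, and $h_{u_k}$ is strongly convex on $\mathbb R_+^p$ with some modulus $H_k\in[\underline H,\overline H]$. ($f$ is strongly convex with modulus $\nu$ if $f(y)-f(x)\ge\langle\nabla f(x),y-x\rangle+\frac\nu2\|y-x\|^2$ on its domain.) \textbf{KL assumption.} There are a neighbourhood $\mathcal U$ of $(\hat u,\hat\theta)$ and $\phi(s)=cs^{1-\rho}$ with $c>0$, $\rho\in[0,1)$, such that $\phi'(|q(u,\theta)-q(\hat u,\hat\theta)|)\,\|\nabla q(u,\theta)\|\ge1$ for all $(u,\theta)\in\mathcal U\cap(\mathcal Y^n\times\mathbb R_+^p)$ with $q(u,\theta)\ne q(\hat u,\hat\theta)$. \textbf{Closeness.} Let $a=\min\{\underline M,\underline H\}$, $A=\max\{\overline M,\overline H\}$. The point $(u_0,\theta_0)$ is \emph{sufficiently close} to $(\hat u,\hat\theta)$ if there are $\psi>0$, $0<\delta<1$ and $L_G\ge0$ such that $B(\psi)\subseteq\mathcal U$, the maps $(u,\theta)\mapsto\nabla m_\theta(u)$ and $(u,\theta)\mapsto\nabla h_u(\theta)$ are Lipschitz with constant $L_G$ on $B(\sqrt{10}\,\psi)$,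 and, with $\Delta_0=q(u_0,\theta_0)-q(\hat u,\hat\theta)$, $$\frac{9(A+2L_G)}{2a(1-\delta)^2}\,\phi(\Delta_0)+\Big(2\sqrt{\tfrac2a}+\tfrac{3}{1-\delta}\sqrt{\tfrac{2+2\delta^2}{a}}\Big)\sqrt{\Delta_0}+\|(u_0,\theta_0)-(\hat u,\hat\theta)\|\le\psi .$$ \textbf{Theorem.} Suppose that $q$ satisfies the KL assumption at the global minimizer $(\hat u,\hat\theta)$, and let $0<\underline M\le\overline M$, $0<\underline H\le\overline H$. Then: (1) there is $\varepsilon>0$ such that every $(u_0,\theta_0)\in\mathcal Y^n\times\mathbb R_+^p$ with $\|(u_0,\theta_0)-(\hat u,\hat\theta)\|<\varepsilon$ is sufficiently close to $(\hat u,\hat\theta)$; (2) for every BCD sequence that satisfies the strong convexity assumption with these constants and whose initial point $(u_0,\theta_0)$ is sufficiently close to $(\hat u,\hat\theta)$, the whole sequence converges: $(u_k,\theta_k)\to(\hat u,\hat\theta)$ as $k\to\infty$. -/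

import Mathlib

open Filter Topology
open scoped RealInnerProductSpace

noncomputable section

/-- The product space `𝒴ⁿ` with the norm `‖u‖ = (∑ i, ‖u i‖²)^(1/2)`. -/
abbrev YVec (Y : Type*) (n : ℕ) : Type _ := PiLp 2 (fun _ : Fin n => Y)

/-- An operator-valued kernel `K : 𝒳 × 𝒳 → ℒ(𝒴)` is nonnegative: it is Hermitian, i.e.
`K(w,z) = K(z,w)*`, and all the matrices `(⟨K(wᵢ,wⱼ)uᵢ, uⱼ⟩)ᵢⱼ` are positive semidefinite. -/
def IsNonnegKernel {X Y : Type*} [NormedAddCommGroup Y] [InnerProductSpace ℝ Y] [CompleteSpace Y]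
    (K : X → X → (Y →L[ℝ] Y)) : Prop :=
  (∀ w z, K w z = ContinuousLinearMap.adjoint (K z w)) ∧
  ∀ (r : ℕ) (w : Fin r → X) (u : Fin r → Y),
    (Matrix.of fun i j => ⟪K (w i) (w j) (u i), u j⟫).PosSemidef

/-- The data of the regression problem: `n` samples `(xᵢ, yᵢ)` with `p` functional covariates
`xᵢ⁽ˡ⁾ ∈ 𝒳ₗ` and responses `yᵢ ∈ 𝒴`, the `p` kernels and the regularization parameters. -/
structure RegressionData (n p : ℕ) (X : Fin p → Type*) (Y : Type*)
    [NormedAddCommGroup Y] [InnerProductSpace ℝ Y] [CompleteSpace Y] where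
  x : Fin n → (l : Fin p) → X l
  y : Fin n → Y
  K : (l : Fin p) → X l → X l → (Y →L[ℝ] Y)
  K_nonneg : ∀ l, IsNonnegKernel (K l)
  lam₁ : ℝ
  lam₂ : ℝ
  lam₁_pos : 0 < lam₁
  lam₂_pos : 0 < lam₂

/-- The nonnegative orthant `ℝ₊ᵖ`. -/
def orthant (p : ℕ) : Set (EuclideanSpace ℝ (Fin p)) := {θ | ∀ l, 0 ≤ θ l}

/-- The norm `‖(u,θ)‖ = ‖u‖ + ‖θ‖` on `𝒴ⁿ × ℝᵖ`. -/
def pairNorm {n p : ℕ} {Y : Type*} [NormedAddCommGroup Y]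
    (z : YVec Y n × EuclideanSpace ℝ (Fin p)) : ℝ := ‖z.1‖ + ‖z.2‖

/-- The closed ball for `pairNorm`. -/
def pairBall {n p : ℕ} {Y : Type*} [NormedAddCommGroup Y]
    (z : YVec Y n × EuclideanSpace ℝ (Fin p)) (r : ℝ) :
    Set (YVec Y n × EuclideanSpace ℝ (Fin p)) := {w | pairNorm (w - z) ≤ r}

namespace RegressionData

variable {n p : ℕ} {X : Fin p → Type*} {Y : Type*}
  [NormedAddCommGroup Y] [InnerProductSpace ℝ Y] [CompleteSpace Y]

/-- The objective function `q(u,θ)`. -/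
def q (D : RegressionData n p X Y) (u : YVec Y n) (θ : EuclideanSpace ℝ (Fin p)) : ℝ :=
  (∑ i, ‖D.y i - ∑ l, ∑ j, θ l • D.K l (D.x j l) (D.x i l) (u j)‖ ^ 2)
    + D.lam₁ * ∑ l, θ l * ∑ i, ∑ j, ⟪D.K l (D.x i l) (D.x j l) (u i), u j⟫
    + D.lam₂ * ∑ l, θ l

/-- The combined kernel `K(xⱼ,xᵢ) = ∑ₗ θₗ Kₗ(xⱼ⁽ˡ⁾,xᵢ⁽ˡ⁾)` at the sample points. -/
def combinedKernel (D : RegressionData n p X Y) (θ : EuclideanSpace ℝ (Fin p)) (j i : Fin n) :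
    Y →L[ℝ] Y :=
  ∑ l, θ l • D.K l (D.x j l) (D.x i l)

/-- The objective `m_θ(u)` of the `u`-subproblem (the part of `q` that depends on `u`). -/
def m (D : RegressionData n p X Y) (θ : EuclideanSpace ℝ (Fin p)) (u : YVec Y n) : ℝ :=
  (∑ i, ‖D.y i - ∑ j, D.combinedKernel θ j i (u j)‖ ^ 2)
    + D.lam₁ * ∑ i, ∑ j, ⟪D.combinedKernel θ i j (u i), u j⟫

/-- The objective `h_u(θ)` of the `θ`-subproblem. -/
def h (D : RegressionData n p X Y) (u : YVec Y n) (θ : EuclideanSpace ℝ (Fin p)) : ℝ :=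
  (∑ i, ‖D.y i - ∑ l, θ l • ∑ j, D.K l (D.x j l) (D.x i l) (u j)‖ ^ 2)
    + D.lam₁ * ∑ l, θ l * ∑ i, ∑ j, ⟪D.K l (D.x i l) (D.x j l) (u i), u j⟫
    + D.lam₂ * ∑ l, θ l

/-- `(û,θ̂)` is a global minimizer of `q` over `𝒴ⁿ × ℝ₊ᵖ`. -/
def IsGlobalMinimizer (D : RegressionData n p X Y) (uhat : YVec Y n)
    (θhat : EuclideanSpace ℝ (Fin p)) : Prop :=
  θhat ∈ orthant p ∧ ∀ u, ∀ θ ∈ orthant p, D.q uhat θhat ≤ D.q u θ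

/-- Block coordinate descent from `(u 0, θ 0)`, without a stopping rule. Every `u (k+1)` is a
minimizer of `m_{θ k}` over `𝒴ⁿ`. Every `θ (k+1)` is a minimizer over `ℝ₊ᵖ` of `h_{u k}`
(simultaneous updates throughout), or every `θ (k+1)` is a minimizer of `h_{u (k+1)}`
(sequential updates throughout). -/
def IsBCD (D : RegressionData n p X Y) (u : ℕ → YVec Y n) (θ : ℕ → EuclideanSpace ℝ (Fin p)) :
    Prop :=
  θ 0 ∈ orthant p ∧
  (∀ k, ∀ v, D.m (θ k) (u (k + 1)) ≤ D.m (θ k) v) ∧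
  (∀ k, θ (k + 1) ∈ orthant p) ∧
  ((∀ k, ∀ η ∈ orthant p, D.h (u k) (θ (k + 1)) ≤ D.h (u k) η) ∨
   (∀ k, ∀ η ∈ orthant p, D.h (u (k + 1)) (θ (k + 1)) ≤ D.h (u (k + 1)) η))

/-- Along the sequence, `m_{θ k}` is strongly convex on `𝒴ⁿ` with a modulus `M k ∈ [Mlo, Mhi]` and
`h_{u k}` is strongly convex on `ℝ₊ᵖ` with a modulus `H k ∈ [Hlo, Hhi]`. -/
def UniformlyStronglyConvex (D : RegressionData n p X Y) (u : ℕ → YVec Y n)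
    (θ : ℕ → EuclideanSpace ℝ (Fin p)) (Mlo Mhi Hlo Hhi : ℝ) : Prop :=
  ∃ M H : ℕ → ℝ, ∀ k,
    (Mlo ≤ M k ∧ M k ≤ Mhi ∧ StrongConvexOn Set.univ (M k) (D.m (θ k))) ∧
    (Hlo ≤ H k ∧ H k ≤ Hhi ∧ StrongConvexOn (orthant p) (H k) (D.h (u k)))

/-- The norm `‖∇q(u,θ)‖ = ‖∇_u q(u,θ)‖ + ‖∇_θ q(u,θ)‖` of the full gradient of `q`. -/
def gradNorm (D : RegressionData n p X Y) (u : YVec Y n) (θ : EuclideanSpace ℝ (Fin p)) : ℝ :=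
  ‖gradient (fun v => D.q v θ) u‖ + ‖gradient (fun η => D.q u η) θ‖

/-- The desingularizing function `φ(s) = c s^(1-ρ)`. -/
def phi (c ρ s : ℝ) : ℝ := c * s ^ (1 - ρ)

/-- `q`, with domain `𝒴ⁿ × ℝ₊ᵖ`, has the Kurdyka–Łojasiewicz property at `(û,θ̂)`, with
neighbourhood `U` and desingularizing function `φ(s) = c s^(1-ρ)`. -/
def KLWith (D : RegressionData n p X Y) (uhat : YVec Y n) (θhat : EuclideanSpace ℝ (Fin p))
    (U : Set (YVec Y n × EuclideanSpace ℝ (Fin p))) (c ρ : ℝ) : Prop :=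
  U ∈ 𝓝 (uhat, θhat) ∧ 0 < c ∧ 0 ≤ ρ ∧ ρ < 1 ∧
  ∀ u, ∀ θ ∈ orthant p, (u, θ) ∈ U → D.q u θ ≠ D.q uhat θhat →
    1 ≤ deriv (phi c ρ) |D.q u θ - D.q uhat θhat| * D.gradNorm u θ

/-- `L` is a Lipschitz constant on the set `S` of both partial gradients
`(u,θ) ↦ ∇m_θ(u)` and `(u,θ) ↦ ∇h_u(θ)`. -/
def PartialGradLipschitz (D : RegressionData n p X Y) (L : ℝ)
    (S : Set (YVec Y n × EuclideanSpace ℝ (Fin p))) : Prop :=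
  0 ≤ L ∧ ∀ z ∈ S, ∀ w ∈ S,
    ‖gradient (D.m z.2) z.1 - gradient (D.m w.2) w.1‖ ≤ L * pairNorm (z - w) ∧
    ‖gradient (D.h z.1) z.2 - gradient (D.h w.1) w.2‖ ≤ L * pairNorm (z - w)

/-- The quantitative closeness of `(u₀,θ₀)` to `(û,θ̂)`, for the lower and upper bounds `a`, `A` of
the moduli of strong convexity and the Kurdyka–Łojasiewicz data `U`, `c`, `ρ`. -/
def SufficientlyClose (D : RegressionData n p X Y) (uhat : YVec Y n)
    (θhat : EuclideanSpace ℝ (Fin p)) (U : Set (YVec Y n × EuclideanSpace ℝ (Fin p)))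
    (c ρ a A : ℝ) (u₀ : YVec Y n) (θ₀ : EuclideanSpace ℝ (Fin p)) : Prop :=
  ∃ ψ δ L : ℝ, 0 < ψ ∧ 0 < δ ∧ δ < 1 ∧
    pairBall (uhat, θhat) ψ ⊆ U ∧
    D.PartialGradLipschitz L (pairBall (uhat, θhat) (√10 * ψ)) ∧
    9 * (A + 2 * L) / (2 * a * (1 - δ) ^ 2) * phi c ρ (D.q u₀ θ₀ - D.q uhat θhat)
      + (2 * √(2 / a) + 3 / (1 - δ) * √((2 + 2 * δ ^ 2) / a)) * √(D.q u₀ θ₀ - D.q uhat θhat)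
      + pairNorm ((u₀, θ₀) - (uhat, θhat)) ≤ ψ

end RegressionData

end

/-! Write `T θ` for the weighted block operator, so that q is ‖y − T θ u‖² + λ₁⟪T θ u, u⟫ + λ₂ ∑
θ_l. This is not jointly convex, but it has a saddle structure: for θ ≥ 0 the fit dominates a
concave function of a dual variable w that is affine in θ (`ridgeFit_eq_dual`). Suppose each block
is optimal given the other and `T θ` is injective. The normal equation then closes the duality gap
at w = u, and optimality of θ says that θ minimizes the penalized dual value at this w. So weak
duality makes the point a global minimizer, and following the two defects in the duality identity
shows that it is the only one (`eq_of_blockwise_minimizer`).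

Convergence is then a compactness argument (`tendsto_of_alternating_minimization`). The objective
decreases, strong convexity forces successive weights together, and the penalty bounds the weights.
The normal equation makes u Lipschitz in θ, which gives convergent subsequences even for
infinite-dimensional 𝒴. Every limit is blockwise optimal and nondegenerate, hence equal to the given
minimizer.

Initial points near the minimizer are sufficiently close because, once ψ, δ and L are fixed, the
left side of the closeness inequality is continuous and vanishes there. -/

section KernelRidge

/-! ### Kernel ridge regression in u for a fixed operator. -/

variable {E : Type*} [NormedAddCommGroup E] [InnerProductSpace ℝ E]

/-- A linear polynomial with nonnegative values near `0⁺` after adding a quadratic term has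
nonnegative slope. -/
lemma nonneg_of_forall_mul_add_sq_nonneg {b c : ℝ}
    (h : ∀ t : ℝ, 0 < t → t ≤ 1 → 0 ≤ t * b + t ^ 2 * c) : 0 ≤ b := by
  have h1 : Tendsto (fun t : ℝ => b + t * c) (𝓝[>] 0) (𝓝 b) := by
    have : Continuous fun t : ℝ => b + t * c := by fun_prop
    simpa using (this.tendsto 0).mono_left nhdsWithin_le_nhds
  refine ge_of_tendsto h1 ?_
  filter_upwards [Ioc_mem_nhdsGT (zero_lt_one (α := ℝ))] with t ht
  have := h t ht.1 ht.2
  have h2 : 0 ≤ t * (b + t * c) := by linarith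
  exact nonneg_of_mul_nonneg_right h2 ht.1

/-- A positive semidefinite symmetric operator annihilates its isotropic vectors. -/
lemma apply_eq_zero_of_inner_self_eq_zero {S : E →L[ℝ] E} (hsymm : ∀ v w, ⟪S v, w⟫ = ⟪v, S w⟫)
    (hpos : ∀ v, 0 ≤ ⟪S v, v⟫) {w : E} (hw : ⟪S w, w⟫ = 0) : S w = 0 := by
  -- Moving from w in the direction −S w changes the quadratic form to first order by −2‖S w‖²,
  -- while it must stay nonnegative.
  have h : 0 ≤ -(2 * ⟪S w, S w⟫) := by
    refine nonneg_of_forall_mul_add_sq_nonneg (c := ⟪S (S w), S w⟫) fun t _ _ => ?_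
    have h1 := hpos (w - t • S w)
    have h2 : ⟪S (S w), w⟫ = ⟪S w, S w⟫ := hsymm _ _
    simp only [map_sub, map_smul, inner_sub_left, inner_sub_right, real_inner_smul_left,
      real_inner_smul_right, hw, h2] at h1
    linarith
  rw [← inner_self_eq_zero (𝕜 := ℝ)]
  exact le_antisymm (by linarith) real_inner_self_nonneg

/-- The fitting term of kernel ridge regression with the operator `S`. -/
noncomputable def ridgeFit (y : E) (lam : ℝ) (S : E →L[ℝ] E) (u : E) : ℝ :=
  ‖y - S u‖ ^ 2 + lam * ⟪S u, u⟫

/-- The kernel ridge objective with a linear penalty on the nonnegative weights. -/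
noncomputable def ridgeObjective {p : ℕ} (y : E) (lam μ : ℝ) (T : EuclideanSpace ℝ (Fin p) →L[ℝ] E →L[ℝ] E)
    (u : E) (θ : EuclideanSpace ℝ (Fin p)) : ℝ :=
  ridgeFit y lam (T θ) u + μ * ∑ l, θ l

variable {y : E} {lam μ : ℝ}

lemma ridgeFit_nonneg {S : E →L[ℝ] E} (hlam : 0 ≤ lam) (hpos : ∀ v, 0 ≤ ⟪S v, v⟫) (u : E) :
    0 ≤ ridgeFit y lam S u := by
  have := hpos u
  unfold ridgeFit
  positivity

/-- The expansion is exact. Symmetry of S lets it factor out of the gradient 2 S(S u + λu − y), the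
form that the normal equation needs. -/
lemma ridgeFit_add_smul {S : E →L[ℝ] E} (hsymm : ∀ v w, ⟪S v, w⟫ = ⟪v, S w⟫) (u w : E) (t : ℝ) :
    ridgeFit y lam S (u + t • w) = ridgeFit y lam S u
      + t * (2 * ⟪S u + lam • u - y, S w⟫) + t ^ 2 * (‖S w‖ ^ 2 + lam * ⟪S w, w⟫) := by
  have h1 : y - S (u + t • w) = (y - S u) - t • S w := by simp [sub_sub]
  have h2 : ⟪S u, w⟫ = ⟪u, S w⟫ := hsymm _ _
  have h3 : ⟪S w, u⟫ = ⟪u, S w⟫ := real_inner_comm _ _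
  unfold ridgeFit
  rw [h1, norm_sub_sq_real]
  simp only [map_add, map_smul, inner_add_left, inner_add_right, inner_sub_left,
    real_inner_smul_left, real_inner_smul_right, norm_smul, h2, h3, mul_pow, Real.norm_eq_abs,
    sq_abs]
  ring

/-- In the midpoint inequality between 0 and w the affine part cancels: a quarter of the quadratic
part is at least M/8 · ‖w‖². -/
lemma le_of_strongConvexOn_ridgeFit {S : E →L[ℝ] E} (hsymm : ∀ v w, ⟪S v, w⟫ = ⟪v, S w⟫) {M : ℝ}
    (h : StrongConvexOn Set.univ M (ridgeFit y lam S)) (w : E) :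
    M / 2 * ‖w‖ ^ 2 ≤ ‖S w‖ ^ 2 + lam * ⟪S w, w⟫ := by
  have h1 := h.2 (Set.mem_univ (0 : E)) (Set.mem_univ w) (by norm_num : (0 : ℝ) ≤ 1 / 2)
    (by norm_num : (0 : ℝ) ≤ 1 / 2) (by norm_num)
  have e1 := ridgeFit_add_smul (y := y) (lam := lam) hsymm 0 w 1
  have e2 := ridgeFit_add_smul (y := y) (lam := lam) hsymm 0 w (1 / 2)
  simp only [one_smul, zero_add, smul_zero, zero_sub, norm_neg, smul_eq_mul] at h1 e1 e2
  linarith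

/-- Criticality only gives S(S u + λu − y) = 0; injectivity strips the outer S. -/
lemma ridgeFit_normal_equation {S : E →L[ℝ] E} (hsymm : ∀ v w, ⟪S v, w⟫ = ⟪v, S w⟫) {u : E}
    (hu : ∀ v, ridgeFit y lam S u ≤ ridgeFit y lam S v) (hinj : ∀ w, S w = 0 → w = 0) :
    S u + lam • u = y := by
  have key : ∀ w, 0 ≤ 2 * ⟪S u + lam • u - y, S w⟫ := fun w => by
    refine nonneg_of_forall_mul_add_sq_nonneg (c := ‖S w‖ ^ 2 + lam * ⟪S w, w⟫) fun t _ _ => ?_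
    have := hu (u + t • w)
    rw [ridgeFit_add_smul hsymm] at this
    linarith
  have h1 : ∀ w, ⟪S (S u + lam • u - y), w⟫ = 0 := fun w => by
    have h1 := key w
    have h2 := key (-w)
    rw [map_neg, inner_neg_right] at h2
    rw [hsymm]
    linarith
  exact sub_eq_zero.1 (hinj _ (inner_self_eq_zero (𝕜 := ℝ) |>.1 (h1 _)))

/-- Weak duality for kernel ridge regression, with its two defects made explicit. -/
lemma ridgeFit_eq_dual {S : E →L[ℝ] E} (hsymm : ∀ v w, ⟪S v, w⟫ = ⟪v, S w⟫) (v w : E) :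
    ridgeFit y lam S v = 2 * lam * ⟪y, w⟫ - lam ^ 2 * ‖w‖ ^ 2 - lam * ⟪S w, w⟫
      + ‖y - S v - lam • w‖ ^ 2 + lam * ⟪S (v - w), v - w⟫ := by
  have h2 : ⟪S w, v⟫ = ⟪S v, w⟫ := by rw [hsymm, real_inner_comm]
  unfold ridgeFit
  rw [norm_sub_sq_real (y - S v)]
  simp only [map_sub, inner_sub_left, inner_sub_right, real_inner_smul_right, norm_smul, h2,
    mul_pow, Real.norm_eq_abs, sq_abs]
  ring

/-- The solution of the normal equation depends in a Lipschitz way on the operator. -/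
lemma norm_sub_le_of_normal_equation {S S' : E →L[ℝ] E} (hlam : 0 < lam)
    (hpos : ∀ v, 0 ≤ ⟪S v, v⟫) (hpos' : ∀ v, 0 ≤ ⟪S' v, v⟫) {u u' : E}
    (hu : S u + lam • u = y) (hu' : S' u' + lam • u' = y) :
    ‖u - u'‖ ≤ ‖y‖ / lam ^ 2 * ‖S - S'‖ := by
  -- Coercivity of R + λ, by testing the equation against v.
  have bound : ∀ {R : E →L[ℝ] E} {z v : E}, (∀ v, 0 ≤ ⟪R v, v⟫) → R v + lam • v = z →
      lam * ‖v‖ ≤ ‖z‖ := fun {R z v} hR hz => by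
    have h1 : ⟪z, v⟫ = ⟪R v, v⟫ + lam * ‖v‖ ^ 2 := by
      rw [← hz, inner_add_left, real_inner_smul_left, real_inner_self_eq_norm_sq]
    have h2 := real_inner_le_norm z v
    have h3 := hR v
    rcases (norm_nonneg v).eq_or_lt with h | h
    · rw [← h]; simp
    · exact le_of_mul_le_mul_right (by nlinarith) h
  have h1 := bound hpos' hu'
  -- The difference u − u' solves the equation for S with right-hand side (S' − S)u'.
  have h2 : lam * ‖u - u'‖ ≤ ‖(S' - S) u'‖ := by
    refine bound hpos ?_
    have h3 : S u + lam • u = S' u' + lam • u' := hu.trans hu'.symm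
    calc S (u - u') + lam • (u - u') = (S u + lam • u) - (S u' + lam • u') := by
          rw [map_sub, smul_sub]; abel
      _ = (S' - S) u' := by rw [h3, sub_apply]; abel
  have h3 := (S' - S).le_opNorm u'
  rw [norm_sub_rev S' S] at h3
  rw [div_mul_eq_mul_div, le_div_iff₀ (by positivity)]
  nlinarith [mul_le_mul_of_nonneg_left h1 (norm_nonneg (S - S')), norm_nonneg (S - S')]

/-! ### The weights, and uniqueness of blockwise minimizers. -/

variable {p : ℕ} {T : EuclideanSpace ℝ (Fin p) →L[ℝ] E →L[ℝ] E}

lemma convex_orthant (p : ℕ) : Convex ℝ (orthant p) := by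
  intro x hx z hz a b ha hb _ l
  have h1 := hx l
  have h2 := hz l
  simp only [PiLp.add_apply, PiLp.smul_apply, smul_eq_mul]
  positivity

lemma isClosed_orthant (p : ℕ) : IsClosed (orthant p) := by
  simp only [orthant, Set.ofPred_forall]
  exact isClosed_iInter fun l => isClosed_le continuous_const (by fun_prop)

lemma ridgeObjective_add_smul (u : E) (θ d : EuclideanSpace ℝ (Fin p)) (t : ℝ) :
    ridgeObjective y lam μ T u (θ + t • d) = ridgeObjective y lam μ T u θ
      + t * (lam * ⟪T d u, u⟫ + μ * ∑ l, d l - 2 * ⟪y - T θ u, T d u⟫) + t ^ 2 * ‖T d u‖ ^ 2 := by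
  have h1 : y - T (θ + t • d) u = (y - T θ u) - t • T d u := by simp [sub_sub]
  unfold ridgeObjective ridgeFit
  rw [h1, norm_sub_sq_real]
  simp only [map_add, map_smul, add_apply, smul_apply, inner_add_left, real_inner_smul_left,
    real_inner_smul_right, norm_smul, mul_pow, Real.norm_eq_abs, sq_abs, PiLp.add_apply,
    PiLp.smul_apply, smul_eq_mul, Finset.sum_add_distrib, ← Finset.mul_sum]
  ring

/-- The same midpoint comparison, limited to differences of orthant points because strong convexity
is only available there. -/
lemma le_of_strongConvexOn_ridgeObjective {u : E} {H : ℝ}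
    (h : StrongConvexOn (orthant p) H (ridgeObjective y lam μ T u))
    {θ η : EuclideanSpace ℝ (Fin p)} (hθ : θ ∈ orthant p) (hη : η ∈ orthant p) :
    H / 2 * ‖η - θ‖ ^ 2 ≤ ‖T (η - θ) u‖ ^ 2 := by
  have h1 := h.2 hθ hη (by norm_num : (0 : ℝ) ≤ 1 / 2) (by norm_num : (0 : ℝ) ≤ 1 / 2) (by norm_num)
  have e1 := ridgeObjective_add_smul (y := y) (lam := lam) (μ := μ) (T := T) u θ (η - θ) 1
  have e2 := ridgeObjective_add_smul (y := y) (lam := lam) (μ := μ) (T := T) u θ (η - θ) (1 / 2)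
  have h3 : θ + (1 / 2 : ℝ) • (η - θ) = (1 / 2 : ℝ) • θ + (1 / 2 : ℝ) • η := by module
  rw [h3] at e2
  rw [one_smul, add_sub_cancel] at e1
  rw [norm_sub_rev] at h1
  simp only [smul_eq_mul] at h1
  linarith

/-- First-order optimality in the weights. -/
lemma ridgeObjective_variational {u : E} {θ η : EuclideanSpace ℝ (Fin p)} (hθ : θ ∈ orthant p)
    (hmin : ∀ η ∈ orthant p, ridgeObjective y lam μ T u θ ≤ ridgeObjective y lam μ T u η)
    (hη : η ∈ orthant p) :
    0 ≤ lam * ⟪T (η - θ) u, u⟫ + μ * ∑ l, (η - θ) l - 2 * ⟪y - T θ u, T (η - θ) u⟫ := by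
  refine nonneg_of_forall_mul_add_sq_nonneg (c := ‖T (η - θ) u‖ ^ 2) fun t h0 h1 => ?_
  have := hmin (θ + t • (η - θ)) ((convex_orthant p).add_smul_sub_mem hθ hη ⟨h0.le, h1⟩)
  rw [ridgeObjective_add_smul] at this
  linarith

/-- Quadratic growth of the objective away from a minimizer in the weights. -/
lemma ridgeObjective_add_le {u : E} {θ η : EuclideanSpace ℝ (Fin p)} (hθ : θ ∈ orthant p)
    (hmin : ∀ η ∈ orthant p, ridgeObjective y lam μ T u θ ≤ ridgeObjective y lam μ T u η)
    (hη : η ∈ orthant p) :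
    ridgeObjective y lam μ T u θ + ‖T (η - θ) u‖ ^ 2 ≤ ridgeObjective y lam μ T u η := by
  have h1 := ridgeObjective_variational hθ hmin hη
  have h2 := ridgeObjective_add_smul (y := y) (lam := lam) (μ := μ) (T := T) u θ (η - θ) 1
  rw [one_smul, add_sub_cancel] at h2
  linarith

/-- A blockwise minimizer at which both blocks are nondegenerate is the only global minimizer. -/
lemma eq_of_blockwise_minimizer (hlam : 0 < lam)
    (hsymm : ∀ θ v w, ⟪T θ v, w⟫ = ⟪v, T θ w⟫) (hpos : ∀ θ ∈ orthant p, ∀ v, 0 ≤ ⟪T θ v, v⟫)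
    {u uhat : E} {θ θhat : EuclideanSpace ℝ (Fin p)} (hθ : θ ∈ orthant p)
    (hθhat : θhat ∈ orthant p)
    (hu : ∀ v, ridgeFit y lam (T θ) u ≤ ridgeFit y lam (T θ) v)
    (hminθ : ∀ η ∈ orthant p, ridgeObjective y lam μ T u θ ≤ ridgeObjective y lam μ T u η)
    (hinj : ∀ w, T θ w = 0 → w = 0)
    (hinj' : ∀ η ∈ orthant p, T (η - θ) u = 0 → η = θ)
    (hhat : ridgeObjective y lam μ T uhat θhat ≤ ridgeObjective y lam μ T u θ) :
    u = uhat ∧ θ = θhat := by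
  have hn := ridgeFit_normal_equation (hsymm θ) hu hinj
  have hres : y - T θ u = lam • u := by rw [← hn]; abel
  have hv := ridgeObjective_variational hθ hminθ hθhat
  -- The same dual variable w = u serves both points: it has no defect at (u, θ), and at (û, θ̂) its
  -- two defects are nonnegative.
  have d1 := ridgeFit_eq_dual (y := y) (lam := lam) (hsymm θ) u u
  have d2 := ridgeFit_eq_dual (y := y) (lam := lam) (hsymm θhat) uhat u
  have hp := hpos θhat hθhat (uhat - u)
  unfold ridgeObjective at hhat
  rw [hres, real_inner_smul_left, real_inner_comm (T (θhat - θ) u) u] at hv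
  rw [hres, sub_self, sub_self] at d1
  simp only [map_zero, inner_zero_left, norm_zero, map_sub, sub_apply, inner_sub_left,
    PiLp.sub_apply, Finset.sum_sub_distrib] at d1 hv
  have hsq := sq_nonneg ‖y - T θhat uhat - lam • u‖
  have hp' := mul_nonneg hlam.le hp
  -- Duality, `hv` and `hhat` form a closed chain of inequalities, so both defects vanish.
  have z1 : ‖y - T θhat uhat - lam • u‖ ^ 2 = 0 := by linarith
  have z2 : ⟪T θhat (uhat - u), uhat - u⟫ = 0 := by
    have : lam * ⟪T θhat (uhat - u), uhat - u⟫ = 0 := by linarith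
    simpa [hlam.ne'] using this
  have z3 := apply_eq_zero_of_inner_self_eq_zero (hsymm θhat) (hpos θhat hθhat) z2
  have z4 : y - T θhat uhat - lam • u = 0 := by simpa using z1
  -- The vanishing defects give T θ̂ u = T θ̂ û = y − λu = T θ u, so θ̂ − θ is invisible at u.
  have hθeq : θhat = θ := by
    refine hinj' _ hθhat ?_
    rw [map_sub, sub_eq_zero] at z3
    rw [z3, ← hres] at z4
    rw [map_sub, sub_apply, sub_eq_zero]
    have : T θ u - T θhat u = 0 := by rw [← z4]; abel
    exact (sub_eq_zero.1 this).symm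
  subst hθeq
  exact ⟨(sub_eq_zero.1 (hinj _ z3)).symm, rfl⟩

/-! ### Convergence of alternating minimization. -/

lemma continuous_ridgeFit : Continuous fun z : E × EuclideanSpace ℝ (Fin p) =>
    ridgeFit y lam (T z.2) z.1 := by
  unfold ridgeFit
  fun_prop

lemma continuous_ridgeObjective : Continuous fun z : E × EuclideanSpace ℝ (Fin p) =>
    ridgeObjective y lam μ T z.1 z.2 := by
  unfold ridgeObjective
  have := continuous_ridgeFit (y := y) (lam := lam) (T := T)
  fun_prop

/-- Alternating minimization converges to the global minimizer when both blocks are uniformly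
nondegenerate along the iterates. -/
theorem tendsto_of_alternating_minimization [CompleteSpace E] (hlam : 0 < lam) (hμ : 0 < μ)
    (hsymm : ∀ θ v w, ⟪T θ v, w⟫ = ⟪v, T θ w⟫) (hpos : ∀ θ ∈ orthant p, ∀ v, 0 ≤ ⟪T θ v, v⟫)
    {uhat : E} {θhat : EuclideanSpace ℝ (Fin p)} (hθhat : θhat ∈ orthant p)
    (hhat : ∀ u, ∀ θ ∈ orthant p, ridgeObjective y lam μ T uhat θhat ≤ ridgeObjective y lam μ T u θ)
    {u : ℕ → E} {θ : ℕ → EuclideanSpace ℝ (Fin p)} (hθ : ∀ k, θ k ∈ orthant p)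
    (hu : ∀ k v, ridgeFit y lam (T (θ k)) (u k) ≤ ridgeFit y lam (T (θ k)) v)
    (hminθ : ∀ k, ∀ η ∈ orthant p,
      ridgeObjective y lam μ T (u k) (θ (k + 1)) ≤ ridgeObjective y lam μ T (u k) η)
    {M H : ℝ} (hM : 0 < M) (hH : 0 < H)
    (hMu : ∀ k w, M * ‖w‖ ^ 2 ≤ ‖T (θ k) w‖ ^ 2 + lam * ⟪T (θ k) w, w⟫)
    (hHθ : ∀ k, ∀ θ' ∈ orthant p, ∀ η ∈ orthant p,
      H * ‖η - θ'‖ ^ 2 ≤ ‖T (η - θ') (u k)‖ ^ 2) :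
    Tendsto (fun k => (u k, θ k)) atTop (𝓝 (uhat, θhat)) := by
  set J := ridgeObjective y lam μ T with hJ
  have hinj : ∀ {θ' : EuclideanSpace ℝ (Fin p)},
      (∀ w, M * ‖w‖ ^ 2 ≤ ‖T θ' w‖ ^ 2 + lam * ⟪T θ' w, w⟫) → ∀ w, T θ' w = 0 → w = 0 := by
    intro θ' h w hw
    have h1 := h w
    simp only [hw, norm_zero, inner_zero_left] at h1
    have h2 : ‖w‖ ^ 2 = 0 := by nlinarith [sq_nonneg ‖w‖]
    simpa using h2
  -- The θ-update gains by quadratic growth, and the following u-update cannot increase the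
  -- objective.
  have hstep : ∀ k, J (u (k + 1)) (θ (k + 1)) + H * ‖θ k - θ (k + 1)‖ ^ 2 ≤ J (u k) (θ k) := by
    intro k
    have h1 := ridgeObjective_add_le (hθ (k + 1)) (hminθ k) (hθ k)
    have h2 := hHθ k _ (hθ (k + 1)) _ (hθ k)
    have h3 : J (u (k + 1)) (θ (k + 1)) ≤ J (u k) (θ (k + 1)) := by
      have := hu (k + 1) (u k)
      simp only [hJ, ridgeObjective]
      linarith
    linarith
  have hanti : Antitone fun k => J (u k) (θ k) := antitone_nat_of_succ_le fun k => by
    have := hstep k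
    have : 0 ≤ H * ‖θ k - θ (k + 1)‖ ^ 2 := by positivity
    linarith
  obtain ⟨r, hr⟩ : ∃ r, Tendsto (fun k => J (u k) (θ k)) atTop (𝓝 r) :=
    ⟨_, tendsto_atTop_ciInf hanti ⟨J uhat θhat, by rintro _ ⟨k, rfl⟩; exact hhat _ _ (hθ k)⟩⟩
  have hdiff : Tendsto (fun k => θ k - θ (k + 1)) atTop (𝓝 0) := by
    have h1 : Tendsto (fun k => J (u k) (θ k) - J (u (k + 1)) (θ (k + 1))) atTop (𝓝 0) := by
      simpa using hr.sub (hr.comp (tendsto_add_atTop_nat 1))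
    have h2 : Tendsto (fun k => H * ‖θ k - θ (k + 1)‖ ^ 2) atTop (𝓝 0) :=
      squeeze_zero (fun k => by positivity) (fun k => by linarith [hstep k]) h1
    have h3 : Tendsto (fun k => ‖θ k - θ (k + 1)‖ ^ 2) atTop (𝓝 0) := by
      simpa [← mul_assoc, hH.ne'] using h2.const_mul H⁻¹
    rw [tendsto_zero_iff_norm_tendsto_zero]
    simpa using h3.sqrt
  have hbdd : ∀ k, ‖θ k‖ ≤ J (u 0) (θ 0) / μ := by
    intro k
    have h1 : J (u k) (θ k) ≤ J (u 0) (θ 0) := hanti (Nat.zero_le k)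
    have h2 := ridgeFit_nonneg (y := y) hlam.le (hpos _ (hθ k)) (u k)
    have h3 : ‖θ k‖ ≤ ∑ l, θ k l := by
      rw [EuclideanSpace.norm_eq]
      refine Real.sqrt_le_iff.2 ⟨Finset.sum_nonneg fun l _ => hθ k l, ?_⟩
      simp only [Real.norm_eq_abs, sq_abs]
      exact Finset.sum_sq_le_sq_sum_of_nonneg fun l _ => hθ k l
    rw [le_div_iff₀ hμ]
    simp only [hJ, ridgeObjective] at h1 ⊢
    nlinarith
  have hnormal : ∀ k, T (θ k) (u k) + lam • u k = y := fun k =>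
    ridgeFit_normal_equation (hsymm _) (hu k) (hinj (hMu k))
  -- This transfers compactness from the finite-dimensional weights to u.
  have hlip : ∀ j k, dist (u j) (u k) ≤ ‖y‖ / lam ^ 2 * ‖T‖ * dist (θ j) (θ k) := by
    intro j k
    rw [dist_eq_norm, dist_eq_norm]
    have h1 := norm_sub_le_of_normal_equation hlam (hpos _ (hθ j)) (hpos _ (hθ k))
      (hnormal j) (hnormal k)
    have h2 := T.le_opNorm (θ j - θ k)
    rw [map_sub] at h2
    rw [mul_assoc]
    exact h1.trans (by gcongr)
  refine tendsto_of_subseq_tendsto fun ns hns => ?_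
  obtain ⟨θ', -, ms, hms, hlim⟩ := (isCompact_closedBall (0 : EuclideanSpace ℝ (Fin p))
    (J (u 0) (θ 0) / μ)).tendsto_subseq (x := fun k => θ (ns k)) fun k => by simpa using hbdd (ns k)
  refine ⟨ms, ?_⟩
  have hsub : Tendsto (fun k => ns (ms k)) atTop atTop := hns.comp hms.tendsto_atTop
  -- `u k` is paired with `θ (k + 1)` in the weight update, so the shifted weights must have the
  -- same limit.
  have hlim' : Tendsto (fun k => θ (ns (ms k) + 1)) atTop (𝓝 θ') := by
    have := hlim.sub (hdiff.comp hsub)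
    simpa using this
  have hcau : CauchySeq fun k => u (ns (ms k)) := by
    rw [cauchySeq_iff_tendsto_dist_atTop_0]
    have h1 := (cauchySeq_iff_tendsto_dist_atTop_0.1 hlim.cauchySeq).const_mul (‖y‖ / lam ^ 2 * ‖T‖)
    rw [mul_zero] at h1
    exact squeeze_zero (fun _ => dist_nonneg) (fun _ => hlip _ _) h1
  obtain ⟨u', hu'⟩ := cauchySeq_tendsto_of_complete hcau
  have hpair := hu'.prodMk_nhds hlim
  have hθ' : θ' ∈ orthant p := (isClosed_orthant p).mem_of_tendsto hlim (.of_forall fun _ => hθ _)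
  have hu'min : ∀ v, ridgeFit y lam (T θ') u' ≤ ridgeFit y lam (T θ') v := fun v => by
    have hc := continuous_ridgeFit (y := y) (lam := lam) (T := T)
    have h1 := (hc.tendsto (u', θ')).comp hpair
    have h2 := (hc.tendsto (v, θ')).comp (tendsto_const_nhds.prodMk_nhds hlim)
    exact le_of_tendsto_of_tendsto' h1 h2 fun k => hu _ v
  have hθ'min : ∀ η ∈ orthant p, J u' θ' ≤ J u' η := fun η hη => by
    have hc := continuous_ridgeObjective (y := y) (lam := lam) (μ := μ) (T := T)
    have h1 := (hc.tendsto (u', θ')).comp (hu'.prodMk_nhds hlim')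
    have h2 := (hc.tendsto (u', η)).comp (hu'.prodMk_nhds tendsto_const_nhds)
    exact le_of_tendsto_of_tendsto' h1 h2 fun k => hminθ _ η hη
  -- Nondegeneracy survives in the limit because the constants do not depend on k.
  have hM' : ∀ w, M * ‖w‖ ^ 2 ≤ ‖T θ' w‖ ^ 2 + lam * ⟪T θ' w, w⟫ := fun w => by
    have hc : Continuous fun η => ‖T η w‖ ^ 2 + lam * ⟪T η w, w⟫ := by fun_prop
    exact ge_of_tendsto' ((hc.tendsto _).comp hlim) fun k => hMu _ w
  have hH' : ∀ η ∈ orthant p, H * ‖η - θ'‖ ^ 2 ≤ ‖T (η - θ') u'‖ ^ 2 := fun η hη => by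
    have hc : Continuous fun v => ‖T (η - θ') v‖ ^ 2 := by fun_prop
    exact ge_of_tendsto' ((hc.tendsto _).comp hu') fun k => hHθ _ _ hθ' _ hη
  obtain ⟨rfl, rfl⟩ := eq_of_blockwise_minimizer hlam hsymm hpos hθ' hθhat hu'min hθ'min
    (hinj hM') (fun η hη h0 => by
      have h1 := hH' η hη
      rw [h0, norm_zero] at h1
      have h2 : ‖η - θ'‖ ^ 2 = 0 := by nlinarith [sq_nonneg ‖η - θ'‖]
      simpa [sub_eq_zero] using h2) (hhat _ _ hθ')
  exact hpair

end KernelRidge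

/-! ### The regression problem in terms of block operators. -/

namespace RegressionData

variable {n p : ℕ} {X : Fin p → Type*} {Y : Type*}
  [NormedAddCommGroup Y] [InnerProductSpace ℝ Y] [CompleteSpace Y]

/-- The block operator `(u_j)_j ↦ (∑ j, K_l(x_j, x_i) u_j)_i` of the `l`-th kernel. -/
noncomputable def blockOp (D : RegressionData n p X Y) (l : Fin p) : YVec Y n →L[ℝ] YVec Y n :=
  (PiLp.continuousLinearEquiv 2 ℝ (fun _ : Fin n => Y)).symm.toContinuousLinearMap ∘L
    ContinuousLinearMap.pi fun i => ∑ j, D.K l (D.x j l) (D.x i l) ∘L PiLp.proj 2 _ j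

/-- The weighted block operator `∑ l, θ_l K_l`. -/
noncomputable def weightedOp (D : RegressionData n p X Y) :
    EuclideanSpace ℝ (Fin p) →L[ℝ] YVec Y n →L[ℝ] YVec Y n :=
  ∑ l, (EuclideanSpace.proj l : EuclideanSpace ℝ (Fin p) →L[ℝ] ℝ).smulRight (D.blockOp l)

variable (D : RegressionData n p X Y)

lemma blockOp_apply (l : Fin p) (u : YVec Y n) (i : Fin n) :
    D.blockOp l u i = ∑ j, D.K l (D.x j l) (D.x i l) (u j) := by
  simp [blockOp]

lemma weightedOp_apply (θ : EuclideanSpace ℝ (Fin p)) (u : YVec Y n) :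
    D.weightedOp θ u = ∑ l, θ l • D.blockOp l u := by
  simp [weightedOp]

lemma weightedOp_apply_apply (θ : EuclideanSpace ℝ (Fin p)) (u : YVec Y n) (i : Fin n) :
    D.weightedOp θ u i = ∑ l, θ l • ∑ j, D.K l (D.x j l) (D.x i l) (u j) := by
  simp [weightedOp_apply, blockOp_apply]

/-- The summed index of the block operator is the first kernel argument, so exchanging the sums
produces the order used in q. -/
lemma inner_blockOp (l : Fin p) (u v : YVec Y n) :
    ⟪D.blockOp l u, v⟫ = ∑ i, ∑ j, ⟪D.K l (D.x i l) (D.x j l) (u i), v j⟫ := by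
  simp only [PiLp.inner_apply, blockOp_apply, sum_inner]
  exact Finset.sum_comm

lemma blockOp_symm (l : Fin p) (u v : YVec Y n) : ⟪D.blockOp l u, v⟫ = ⟪u, D.blockOp l v⟫ := by
  rw [real_inner_comm (D.blockOp l v) u, inner_blockOp, inner_blockOp, Finset.sum_comm]
  refine Finset.sum_congr rfl fun i _ => Finset.sum_congr rfl fun j _ => ?_
  rw [(D.K_nonneg l).1 (D.x j l) (D.x i l), ContinuousLinearMap.adjoint_inner_left,
    real_inner_comm]

lemma inner_blockOp_self_nonneg (l : Fin p) (u : YVec Y n) : 0 ≤ ⟪D.blockOp l u, u⟫ := by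
  rw [inner_blockOp]
  -- The vectors `u i` are already inside the matrix, so the all-ones vector is the right test
  -- vector.
  have h := ((D.K_nonneg l).2 n (fun i => D.x i l) u).dotProduct_mulVec_nonneg (fun _ => 1)
  simpa [dotProduct, Matrix.mulVec] using h

lemma inner_weightedOp (θ : EuclideanSpace ℝ (Fin p)) (u v : YVec Y n) :
    ⟪D.weightedOp θ u, v⟫ = ∑ l, θ l * ⟪D.blockOp l u, v⟫ := by
  simp [weightedOp_apply, sum_inner, real_inner_smul_left]

lemma weightedOp_symm (θ : EuclideanSpace ℝ (Fin p)) (u v : YVec Y n) :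
    ⟪D.weightedOp θ u, v⟫ = ⟪u, D.weightedOp θ v⟫ := by
  rw [real_inner_comm (D.weightedOp θ v) u, inner_weightedOp, inner_weightedOp]
  exact Finset.sum_congr rfl fun l _ => by rw [blockOp_symm, real_inner_comm]

lemma inner_weightedOp_self_nonneg {θ : EuclideanSpace ℝ (Fin p)} (hθ : θ ∈ orthant p)
    (u : YVec Y n) : 0 ≤ ⟪D.weightedOp θ u, u⟫ := by
  rw [inner_weightedOp]
  exact Finset.sum_nonneg fun l _ => mul_nonneg (hθ l) (D.inner_blockOp_self_nonneg l u)

lemma combinedKernel_apply (θ : EuclideanSpace ℝ (Fin p)) (j i : Fin n) (v : Y) :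
    D.combinedKernel θ j i v = ∑ l, θ l • D.K l (D.x j l) (D.x i l) v := by
  simp [combinedKernel]

lemma h_eq (u : YVec Y n) (θ : EuclideanSpace ℝ (Fin p)) :
    D.h u θ = ridgeObjective (WithLp.toLp 2 D.y) D.lam₁ D.lam₂ D.weightedOp u θ := by
  simp only [h, ridgeObjective, ridgeFit, PiLp.norm_sq_eq_of_L2, PiLp.sub_apply,
    weightedOp_apply_apply, inner_weightedOp, inner_blockOp]

lemma q_eq (u : YVec Y n) (θ : EuclideanSpace ℝ (Fin p)) :
    D.q u θ = ridgeObjective (WithLp.toLp 2 D.y) D.lam₁ D.lam₂ D.weightedOp u θ := by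
  simp only [← h_eq, q, h, Finset.smul_sum]

lemma m_eq (u : YVec Y n) (θ : EuclideanSpace ℝ (Fin p)) :
    D.m θ u = ridgeFit (WithLp.toLp 2 D.y) D.lam₁ (D.weightedOp θ) u := by
  have h1 : ∀ i, ∑ j, D.combinedKernel θ j i (u j) = D.weightedOp θ u i := fun i => by
    simp only [combinedKernel_apply, weightedOp_apply_apply, Finset.smul_sum]
    exact Finset.sum_comm
  have h2 : ∑ i, ∑ j, ⟪D.combinedKernel θ i j (u i), u j⟫ = ⟪D.weightedOp θ u, u⟫ := by
    rw [Finset.sum_comm]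
    simp only [← sum_inner, h1, PiLp.inner_apply]
  simp only [m, h1, h2, ridgeFit, PiLp.norm_sq_eq_of_L2, PiLp.sub_apply]

end RegressionData

/-! ### Neighbourhoods, local Lipschitz gradients and closeness. -/

lemma norm_le_pairNorm {n p : ℕ} {Y : Type*} [NormedAddCommGroup Y]
    (z : YVec Y n × EuclideanSpace ℝ (Fin p)) : ‖z‖ ≤ pairNorm z := by
  have h1 := norm_nonneg z.1
  have h2 := norm_nonneg z.2
  rw [Prod.norm_def, pairNorm]
  exact max_le (by linarith) (by linarith)

lemma mem_pairBall {n p : ℕ} {Y : Type*} [NormedAddCommGroup Y]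
    {w z : YVec Y n × EuclideanSpace ℝ (Fin p)} {r : ℝ} :
    w ∈ pairBall z r ↔ pairNorm (w - z) ≤ r :=
  Iff.rfl

lemma exists_pairBall_subset {n p : ℕ} {Y : Type*} [NormedAddCommGroup Y]
    {z : YVec Y n × EuclideanSpace ℝ (Fin p)} {S : Set (YVec Y n × EuclideanSpace ℝ (Fin p))}
    (hS : S ∈ 𝓝 z) : ∃ r > 0, pairBall z r ⊆ S := by
  obtain ⟨r, hr, h⟩ := Metric.nhds_basis_closedBall.mem_iff.1 hS
  refine ⟨r, hr, fun w hw => h ?_⟩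
  rw [mem_closedBall_iff_norm]
  exact (norm_le_pairNorm _).trans (mem_pairBall.1 hw)

lemma pairBall_subset_pairBall {n p : ℕ} {Y : Type*} [NormedAddCommGroup Y]
    {z : YVec Y n × EuclideanSpace ℝ (Fin p)} {r s : ℝ} (h : r ≤ s) :
    pairBall z r ⊆ pairBall z s :=
  fun _ hw => mem_pairBall.2 ((mem_pairBall.1 hw).trans h)

/-- The gradient of a `C²` function with respect to one argument is locally Lipschitz. -/
lemma exists_lipschitzOnWith_gradient {Z F : Type*} [NormedAddCommGroup Z] [NormedSpace ℝ Z]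
    [NormedAddCommGroup F] [InnerProductSpace ℝ F] [CompleteSpace F] {f : Z → F → ℝ} {g : Z → F}
    (hf : ContDiff ℝ 2 fun w : Z × F => f w.1 w.2) (hg : ContDiff ℝ 2 g) (z : Z) :
    ∃ C, ∃ S ∈ 𝓝 z, LipschitzOnWith C (fun w => gradient (f w) (g w)) S := by
  have h1 : ContDiff ℝ 1 fun w => fderiv ℝ (f w) (g w) :=
    ContDiff.fderiv hf (hg.of_le one_le_two) le_rfl
  obtain ⟨C, S, hS, h⟩ := h1.contDiffAt (x := z) |>.exists_lipschitzOnWith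
  refine ⟨C, S, hS, LipschitzOnWith.of_dist_le_mul fun w hw w' hw' => ?_⟩
  -- The gradient is the Riesz image of the derivative, and the Riesz map is an isometry.
  simp only [gradient, LinearIsometryEquiv.dist_map]
  exact h.dist_le_mul _ hw _ hw'

lemma contDiff_ridgeFit {E Z : Type*} [NormedAddCommGroup E] [InnerProductSpace ℝ E]
    [NormedAddCommGroup Z] [NormedSpace ℝ Z] {p : ℕ} {y : E} {lam : ℝ}
    {T : EuclideanSpace ℝ (Fin p) →L[ℝ] E →L[ℝ] E} {f : Z → E} {g : Z → EuclideanSpace ℝ (Fin p)}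
    (hf : ContDiff ℝ 2 f) (hg : ContDiff ℝ 2 g) :
    ContDiff ℝ 2 fun z => ridgeFit y lam (T (g z)) (f z) := by
  have h0 : ContDiff ℝ 2 fun z => T (g z) := T.contDiff.comp hg
  have h : ContDiff ℝ 2 fun z => T (g z) (f z) := h0.clm_apply hf
  exact ((contDiff_const.sub h).norm_sq ℝ).add (contDiff_const.mul (h.inner ℝ hf))

namespace RegressionData

variable {n p : ℕ} {X : Fin p → Type*} {Y : Type*}
  [NormedAddCommGroup Y] [InnerProductSpace ℝ Y] [CompleteSpace Y] (D : RegressionData n p X Y)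

lemma contDiff_m {Z : Type*} [NormedAddCommGroup Z] [NormedSpace ℝ Z] {f : Z → YVec Y n}
    {g : Z → EuclideanSpace ℝ (Fin p)} (hf : ContDiff ℝ 2 f) (hg : ContDiff ℝ 2 g) :
    ContDiff ℝ 2 fun z => D.m (g z) (f z) := by
  simp only [m_eq]
  exact contDiff_ridgeFit hf hg

lemma contDiff_h {Z : Type*} [NormedAddCommGroup Z] [NormedSpace ℝ Z] {f : Z → YVec Y n}
    {g : Z → EuclideanSpace ℝ (Fin p)} (hf : ContDiff ℝ 2 f) (hg : ContDiff ℝ 2 g) :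
    ContDiff ℝ 2 fun z => D.h (f z) (g z) := by
  simp only [h_eq, ridgeObjective, ← m_eq]
  refine (D.contDiff_m hf hg).add (contDiff_const.mul (ContDiff.sum fun l _ => ?_))
  exact (EuclideanSpace.proj (𝕜 := ℝ) l).contDiff.comp hg

lemma exists_partialGradLipschitz (z : YVec Y n × EuclideanSpace ℝ (Fin p)) :
    ∃ L, ∃ r > 0, D.PartialGradLipschitz L (pairBall z r) := by
  have hm : ContDiff ℝ 2 fun w : (YVec Y n × EuclideanSpace ℝ (Fin p)) × YVec Y n =>
      D.m w.1.2 w.2 := D.contDiff_m contDiff_snd (contDiff_snd.comp contDiff_fst)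
  have hh : ContDiff ℝ 2 fun w : (YVec Y n × EuclideanSpace ℝ (Fin p)) × EuclideanSpace ℝ (Fin p) =>
      D.h w.1.1 w.2 := D.contDiff_h (contDiff_fst.comp contDiff_fst) contDiff_snd
  obtain ⟨C₁, S₁, hS₁, h₁⟩ := exists_lipschitzOnWith_gradient
    (f := fun (w : YVec Y n × EuclideanSpace ℝ (Fin p)) v => D.m w.2 v) hm contDiff_fst z
  obtain ⟨C₂, S₂, hS₂, h₂⟩ := exists_lipschitzOnWith_gradient
    (f := fun (w : YVec Y n × EuclideanSpace ℝ (Fin p)) η => D.h w.1 η) hh contDiff_snd z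
  obtain ⟨r, hr, hsub⟩ := exists_pairBall_subset (inter_mem hS₁ hS₂)
  refine ⟨max C₁ C₂, r, hr, by positivity, fun w hw w' hw' => ?_⟩
  have hle := norm_le_pairNorm (w - w')
  have g₁ := h₁.dist_le_mul _ (hsub hw).1 _ (hsub hw').1
  have g₂ := h₂.dist_le_mul _ (hsub hw).2 _ (hsub hw').2
  rw [dist_eq_norm, dist_eq_norm] at g₁ g₂
  exact ⟨g₁.trans (by gcongr; exact le_max_left _ _), g₂.trans (by gcongr; exact le_max_right _ _)⟩

lemma continuous_phi {c ρ : ℝ} (hρ : ρ < 1) : Continuous (phi c ρ) := by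
  unfold phi
  exact continuous_const.mul (continuous_id.rpow_const fun _ => Or.inr (by linarith))

lemma phi_zero {c ρ : ℝ} (hρ : ρ < 1) : phi c ρ 0 = 0 := by
  rw [phi, Real.zero_rpow (by linarith), mul_zero]

lemma continuous_q :
    Continuous fun z : YVec Y n × EuclideanSpace ℝ (Fin p) => D.q z.1 z.2 := by
  simpa only [q_eq] using continuous_ridgeObjective

/-- Points near the reference point are sufficiently close to it. -/
theorem eventually_sufficientlyClose {uhat : YVec Y n} {θhat : EuclideanSpace ℝ (Fin p)}
    {U : Set (YVec Y n × EuclideanSpace ℝ (Fin p))} {c ρ : ℝ} (hU : U ∈ 𝓝 (uhat, θhat))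
    (hρ : ρ < 1) (a A : ℝ) :
    ∀ᶠ z in 𝓝 (uhat, θhat), D.SufficientlyClose uhat θhat U c ρ a A z.1 z.2 := by
  obtain ⟨L, r, hr, hL⟩ := D.exists_partialGradLipschitz (uhat, θhat)
  obtain ⟨s, hs, hsU⟩ := exists_pairBall_subset hU
  have h10 : (0 : ℝ) < √10 := by positivity
  -- The first bound fits the √10-enlarged ball into the Lipschitz region, the second fits the ball
  -- into U.
  set ψ := min (r / √10) s with hψ
  have hψ0 : 0 < ψ := lt_min (by positivity) hs
  have hψr : √10 * ψ ≤ r := by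
    rw [mul_comm, ← le_div_iff₀ h10]
    exact min_le_left _ _
  -- Any fixed δ in (0, 1) would do; 1/2 is taken. All terms vanish at the reference point, the
  -- φ-term because 1 − ρ > 0.
  have hcont : Continuous fun z : YVec Y n × EuclideanSpace ℝ (Fin p) =>
      9 * (A + 2 * L) / (2 * a * (1 - 1 / 2) ^ 2) * phi c ρ (D.q z.1 z.2 - D.q uhat θhat)
        + (2 * √(2 / a) + 3 / (1 - 1 / 2) * √((2 + 2 * (1 / 2) ^ 2) / a))
          * √(D.q z.1 z.2 - D.q uhat θhat)
        + pairNorm ((z.1, z.2) - (uhat, θhat)) := by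
    have h1 := D.continuous_q
    have h2 := (continuous_phi (c := c) hρ).comp (h1.sub (continuous_const (y := D.q uhat θhat)))
    simp only [Function.comp_def] at h2
    unfold pairNorm
    fun_prop
  have hlim := hcont.tendsto (uhat, θhat)
  simp only [sub_self, phi_zero hρ, Real.sqrt_zero, mul_zero, add_zero, pairNorm, Prod.fst_zero,
    Prod.snd_zero, norm_zero] at hlim
  filter_upwards [hlim.eventually_le_const hψ0] with z hz
  exact ⟨ψ, 1 / 2, L, hψ0, by norm_num, by norm_num,
    (pairBall_subset_pairBall (min_le_right _ _)).trans hsU,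
    ⟨hL.1, fun w hw w' hw' => hL.2 w (pairBall_subset_pairBall hψr hw) w'
      (pairBall_subset_pairBall hψr hw')⟩, hz⟩

/-! ### Block coordinate descent as alternating chains. -/

lemma IsBCD.mem_orthant {D : RegressionData n p X Y} {u : ℕ → YVec Y n}
    {θ : ℕ → EuclideanSpace ℝ (Fin p)} (h : D.IsBCD u θ) : ∀ k, θ k ∈ orthant p
  | 0 => h.1
  | k + 1 => h.2.2.1 k

/-- A subchain of the iterates along which each block is minimized given the preceding one
converges to the global minimizer. -/
lemma tendsto_of_alternating_chain {D : RegressionData n p X Y} {uhat : YVec Y n}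
    {θhat : EuclideanSpace ℝ (Fin p)} (hmin : D.IsGlobalMinimizer uhat θhat) {u : ℕ → YVec Y n}
    {θ : ℕ → EuclideanSpace ℝ (Fin p)} (hbcd : D.IsBCD u θ) {Mlo Mhi Hlo Hhi : ℝ} (hM : 0 < Mlo)
    (hH : 0 < Hlo) (hconv : D.UniformlyStronglyConvex u θ Mlo Mhi Hlo Hhi) (s : ℕ → ℕ)
    (hs : ∀ k, ∀ η ∈ orthant p, D.h (u (s k + 1)) (θ (s (k + 1))) ≤ D.h (u (s k + 1)) η) :
    Tendsto (fun k => (u (s k + 1), θ (s k))) atTop (𝓝 (uhat, θhat)) := by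
  obtain ⟨M, H, hMH⟩ := hconv
  -- The halves of the moduli are the constants left by the midpoint comparisons.
  refine tendsto_of_alternating_minimization (y := WithLp.toLp 2 D.y) (lam := D.lam₁)
    (μ := D.lam₂) (T := D.weightedOp) (M := Mlo / 2) (H := Hlo / 2) D.lam₁_pos D.lam₂_pos
    D.weightedOp_symm (fun θ hθ => D.inner_weightedOp_self_nonneg hθ) hmin.1
    (fun v η hη => ?_) (fun k => hbcd.mem_orthant _) (fun k v => ?_) (fun k η hη => ?_)
    (by positivity) (by positivity) (fun k w => ?_) (fun k θ' hθ' η hη => ?_)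
  · simpa only [q_eq] using hmin.2 v η hη
  · simpa only [m_eq] using hbcd.2.1 (s k) v
  · simpa only [h_eq] using hs k η hη
  · have h1 := (hMH (s k)).1.2.2.mono (hMH (s k)).1.1
    rw [show D.m (θ (s k)) = _ from funext fun v => D.m_eq v _] at h1
    exact le_of_strongConvexOn_ridgeFit (D.weightedOp_symm _) h1 w
  · have h1 := (hMH (s k + 1)).2.2.2.mono (hMH (s k + 1)).2.1
    rw [show D.h (u (s k + 1)) = _ from funext fun η => D.h_eq _ η] at h1
    exact le_of_strongConvexOn_ridgeObjective h1 hθ' hη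

/-- Both variants of block coordinate descent converge to the global minimizer. Sequential updates
form one alternating chain, simultaneous updates interleave two. -/
theorem IsBCD.tendsto {D : RegressionData n p X Y} {uhat : YVec Y n}
    {θhat : EuclideanSpace ℝ (Fin p)} (hmin : D.IsGlobalMinimizer uhat θhat) {u : ℕ → YVec Y n}
    {θ : ℕ → EuclideanSpace ℝ (Fin p)} (hbcd : D.IsBCD u θ) {Mlo Mhi Hlo Hhi : ℝ} (hM : 0 < Mlo)
    (hH : 0 < Hlo) (hconv : D.UniformlyStronglyConvex u θ Mlo Mhi Hlo Hhi) :
    Tendsto (fun k => (u k, θ k)) atTop (𝓝 (uhat, θhat)) := by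
  -- Here `u (k + 1)` is the minimizer belonging to `θ k`; the shift is undone afterwards blockwise.
  suffices h : Tendsto (fun k => (u (k + 1), θ k)) atTop (𝓝 (uhat, θhat)) from
    ((tendsto_add_atTop_iff_nat 1).1 h.fst_nhds).prodMk_nhds h.snd_nhds
  rcases hbcd.2.2.2 with hsim | hseq
  -- Under simultaneous updates `θ (k + 2)` depends on `u (k + 1)`, which depends on `θ k`, so the
  -- two parities decouple.
  · have heven := tendsto_of_alternating_chain hmin hbcd hM hH hconv (fun k => 2 * k)
      fun k => hsim (2 * k + 1)
    have hodd := tendsto_of_alternating_chain hmin hbcd hM hH hconv (fun k => 2 * k + 1)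
      fun k => hsim (2 * k + 1 + 1)
    rw [tendsto_iff_forall_eventually_mem] at heven hodd ⊢
    intro V hV
    obtain ⟨a, ha⟩ := eventually_atTop.1 (heven V hV)
    obtain ⟨b, hb⟩ := eventually_atTop.1 (hodd V hV)
    refine eventually_atTop.2 ⟨2 * (a + b) + 1, fun k hk => ?_⟩
    obtain ⟨j, rfl | rfl⟩ := Nat.even_or_odd' k
    · exact ha j (by omega)
    · exact hb j (by omega)
  · exact tendsto_of_alternating_chain hmin hbcd hM hH hconv id hseq

end RegressionData

theorem mainTheorem7 {n p : ℕ} {X : Fin p → Type*} {Y : Type*}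
    [NormedAddCommGroup Y] [InnerProductSpace ℝ Y] [CompleteSpace Y]
    (D : RegressionData n p X Y)
    (uhat : YVec Y n) (θhat : EuclideanSpace ℝ (Fin p))
    (hmin : D.IsGlobalMinimizer uhat θhat)
    (U : Set (YVec Y n × EuclideanSpace ℝ (Fin p))) (c ρ : ℝ)
    (hKL : D.KLWith uhat θhat U c ρ)
    (Mlo Mhi Hlo Hhi : ℝ) (hMlo : 0 < Mlo) (hM : Mlo ≤ Mhi) (hHlo : 0 < Hlo) (hH : Hlo ≤ Hhi) :
    (∃ ε : ℝ, 0 < ε ∧ ∀ u₀, ∀ θ₀ ∈ orthant p, pairNorm ((u₀, θ₀) - (uhat, θhat)) < ε →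
      D.SufficientlyClose uhat θhat U c ρ (min Mlo Hlo) (max Mhi Hhi) u₀ θ₀) ∧
    (∀ (u : ℕ → YVec Y n) (θ : ℕ → EuclideanSpace ℝ (Fin p)),
      D.IsBCD u θ →
      D.UniformlyStronglyConvex u θ Mlo Mhi Hlo Hhi →
      D.SufficientlyClose uhat θhat U c ρ (min Mlo Hlo) (max Mhi Hhi) (u 0) (θ 0) →
      Tendsto (fun k => (u k, θ k)) atTop (𝓝 (uhat, θhat))) := by
  refine ⟨?_, fun u θ hbcd hconv _ => hbcd.tendsto hmin hMlo hHlo hconv⟩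
  have hclose := D.eventually_sufficientlyClose (c := c) hKL.1 hKL.2.2.2.1
    (min Mlo Hlo) (max Mhi Hhi)
  obtain ⟨S, hS, hSclose⟩ := hclose.exists_mem
  obtain ⟨r, hr, hsub⟩ := exists_pairBall_subset hS
  refine ⟨r, hr, fun u₀ θ₀ _ h => ?_⟩
  have hmem : (u₀, θ₀) ∈ pairBall (uhat, θhat) r := mem_pairBall.2 h.le
  have hc := hSclose (u₀, θ₀) (hsub hmem)
  exact hc
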